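/- A house allocation instance with ties (HAT) consists of finite sets $A$ of agents and $H$ of houses, where each agent ranks a subset of the houses (its list), ties allowed. A matching is a matching of the bipartite graph with edges $(a,h)$, $h$ on the list of $a$. An agent prefers $M$ to $N$ if it is matched in $M$ and unmatched in $N$, or is matched in both and strictly prefers its house in $M$. A matching $M$ is popular if for no matching $N$ the agents preferring $N$ to $M$ outnumber those preferring $M$ to $N$. Let $G=(\mathcal A\cup\mathcal H,E)$ be the HAT instance obtained from a given one by adding to the list of each agent $a$ a private last-resort house $l(a)$, listed by $a$ alone and ranked strictly below all its other houses (so $\mathcal H$ includes the last-resort houses). Let $f(a)$ be the set of most preferred houses of $a$, and let $G_1$ be the first-choice graph, with edges $(a,h)$, $h\in f(a)$. Let $M_1$ be any maximum matching of $G_1$. A vertex is even (odd) if some alternating path of even (odd) length with respect to $M_1$ leads to it from an unmatched vertex, and unreachable if no alternating path from an unmatched vertex leads to it. Write $\mathcal E_l,\mathcal O_l,\mathcal U_l$ for the sets of even, odd and unreachable agents and $\mathcal E_r,\mathcal O_r,\mathcal U_r$ for those of houses. Let $s(a)$ be the set of most preferred houses of $a$ in $\mathcal E_r$. Let $\mathcal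 F=\bigcup_a f(a)$ and $\mathcal S=\bigcup_a s(a)$, and $\mathcal E_r^\star=\mathcal E_r\setminus(\mathcal F\cup\mathcal S)$. Define the bipartite graph $G'$ as follows. Its right side is $\mathcal H\setminus\mathcal E_r^\star$. Its left side is $\mathcal A\cup\mathcal D$, where $\mathcal D$ is a set of $\max(0,\,|\mathcal H|-|\mathcal E_r^\star|-|\mathcal A|)$ new dummy agents. Its edges are: the edges of $G_1$ between $\mathcal U_l$ and $\mathcal U_r$, between $\mathcal O_l$ and $\mathcal E_r$, and between $\mathcal E_l$ and $\mathcal O_r$; the edges $(a,h)$ with $a\in\mathcal E_l$ and $h\in s(a)$; and all pairs $(d,h)$ with $d\in\mathcal D$ and $h\in\mathcal E_r\setminus\mathcal E_r^\star$. Then: 1. if $G$ has a popular matching, then $|\mathcal A|\le|\mathcal H|-|\mathcal E_r^\star|$ (so $|\mathcal D|=|\mathcal H|-|\mathcal E_r^\star|-|\mathcal A|$ and the two sides of $G'$ have equal size); 2. the number of perfect matchings of $G'$ equals $|\mathcal D|!$ times the number of popular matchings of $G$; 3. the number of popular matchings of $G$ equals that of the given instance without last-resort houses. -/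

import Mathlib

/-- The bipartite graph on `L ⊕ R` whose edges are the pairs `(x, y)` with `r x y`. -/
def bipartiteGraph {L R : Type*} (r : L → R → Prop) : SimpleGraph (L ⊕ R) where
  Adj
    | Sum.inl x, Sum.inr y => r x y
    | Sum.inr y, Sum.inl x => r x y
    | _, _ => False
  symm := ⟨by rintro (x | x) (y | y) h <;> exact h⟩
  loopless := ⟨by rintro (x | x) h <;> exact h⟩

section Matchings

variable {V : Type*} {G : SimpleGraph V}

/-- `M` is a matching of `G` with the largest possible number of edges. -/
def IsMaximumMatching (M : G.Subgraph) : Prop :=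
  M.IsMatching ∧ ∀ N : G.Subgraph, N.IsMatching → N.edgeSet.ncard ≤ M.edgeSet.ncard

/-- `p` is an alternating path with respect to `M`: a path on which, of any two consecutive
edges, exactly one belongs to `M`. -/
def IsAlternatingPath (M : G.Subgraph) {u v : V} (p : G.Walk u v) : Prop :=
  p.IsPath ∧ p.edges.IsChain (fun e e' => (e ∈ M.edgeSet ↔ e' ∉ M.edgeSet))

/-- Vertices reached by an even-length alternating path from an unmatched vertex. -/
def evenVerts (M : G.Subgraph) : Set V :=
  {v | ∃ u, u ∉ M.support ∧ ∃ p : G.Walk u v, IsAlternatingPath M p ∧ Even p.length}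

/-- Vertices reached by an odd-length alternating path from an unmatched vertex. -/
def oddVerts (M : G.Subgraph) : Set V :=
  {v | ∃ u, u ∉ M.support ∧ ∃ p : G.Walk u v, IsAlternatingPath M p ∧ Odd p.length}

/-- Vertices reached by no alternating path from an unmatched vertex. -/
def unreachableVerts (M : G.Subgraph) : Set V :=
  {v | ∀ u, u ∉ M.support → ∀ p : G.Walk u v, ¬ IsAlternatingPath M p}

end Matchings

/-- A house allocation instance with ties: agent `a` ranks the houses in `list a`, lower rank
meaning higher preference and equal rank meaning a tie. Only the values `rank a h` with
`h ∈ list a` carry meaning, and only through their order. -/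
structure HAT (A H : Type*) where
  list : A → Set H
  rank : A → H → ℕ

namespace HAT

variable {A H : Type*}

/-- The bipartite graph of the instance. -/
def graph (I : HAT A H) : SimpleGraph (A ⊕ H) :=
  bipartiteGraph fun a h => h ∈ I.list a

/-- Agent `a` prefers `M` to `N`. -/
def Prefers (I : HAT A H) (M N : I.graph.Subgraph) (a : A) : Prop :=
  (Sum.inl a ∈ M.support ∧ Sum.inl a ∉ N.support) ∨
    ∃ h h' : H, M.Adj (Sum.inl a) (Sum.inr h) ∧ N.Adj (Sum.inl a) (Sum.inr h') ∧
      I.rank a h < I.rank a h'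

/-- The number of agents that prefer `M` to `N`. -/
noncomputable def votes (I : HAT A H) (M N : I.graph.Subgraph) : ℕ :=
  {a : A | I.Prefers M N a}.ncard

def MorePopular (I : HAT A H) (M N : I.graph.Subgraph) : Prop :=
  I.votes N M < I.votes M N

def IsPopular (I : HAT A H) (M : I.graph.Subgraph) : Prop :=
  M.IsMatching ∧ ¬ ∃ N : I.graph.Subgraph, N.IsMatching ∧ I.MorePopular N M

noncomputable def numPopular (I : HAT A H) : ℕ :=
  Nat.card {M : I.graph.Subgraph // I.IsPopular M}

/-- Add for every agent `a` a private last-resort house `Sum.inr a`, which only `a` lists, and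
which `a` ranks strictly below all other houses. -/
def withLastResort [Fintype H] (I : HAT A H) : HAT A (H ⊕ A) where
  list a := {x | (∃ h ∈ I.list a, x = Sum.inl h) ∨ x = Sum.inr a}
  rank a
    | Sum.inl h => I.rank a h
    | Sum.inr _ => Finset.univ.sup (I.rank a) + 1

/-- The first choices `f(a)`: the most preferred houses on the list of `a`. -/
def firstChoices (I : HAT A H) (a : A) : Set H :=
  {h | h ∈ I.list a ∧ ∀ h' ∈ I.list a, I.rank a h ≤ I.rank a h'}

/-- The first-choice graph. -/
def firstChoiceGraph (I : HAT A H) : SimpleGraph (A ⊕ H) :=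
  bipartiteGraph fun a h => h ∈ I.firstChoices a

section Reduction

variable (I : HAT A H) (M₁ : I.firstChoiceGraph.Subgraph)

/-! The parts of the decomposition: `L` for agents (left), `R` for houses (right). -/

def evenL : Set A := {a | Sum.inl a ∈ evenVerts M₁}

def oddL : Set A := {a | Sum.inl a ∈ oddVerts M₁}

def unreachableL : Set A := {a | Sum.inl a ∈ unreachableVerts M₁}

def evenR : Set H := {h | Sum.inr h ∈ evenVerts M₁}

def oddR : Set H := {h | Sum.inr h ∈ oddVerts M₁}

def unreachableR : Set H := {h | Sum.inr h ∈ unreachableVerts M₁}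

/-- The houses `s(a)`: the most preferred even houses on the list of `a`. -/
def secondChoices (a : A) : Set H :=
  {h | h ∈ I.list a ∧ h ∈ I.evenR M₁ ∧
    ∀ h' ∈ I.list a, h' ∈ I.evenR M₁ → I.rank a h ≤ I.rank a h'}

/-- The set of f-houses. -/
def fHouses : Set H := {h | ∃ a, h ∈ I.firstChoices a}

/-- The set of s-houses. -/
def sHouses : Set H := {h | ∃ a, h ∈ I.secondChoices M₁ a}

/-- Even houses that are f-houses but not s-houses. -/
def evenRf : Set H := I.evenR M₁ ∩ (I.fHouses ∩ (I.sHouses M₁)ᶜ)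

/-- Even houses that are s-houses but not f-houses. -/
def evenRs : Set H := I.evenR M₁ ∩ (I.fHousesᶜ ∩ I.sHouses M₁)

/-- Even houses that are both f-houses and s-houses. -/
def evenRfs : Set H := I.evenR M₁ ∩ (I.fHouses ∩ I.sHouses M₁)

/-- Even houses that are neither f-houses nor s-houses. -/
def evenRstar : Set H := I.evenR M₁ ∩ (I.fHouses ∪ I.sHouses M₁)ᶜ

/-- The houses that remain after deleting the even houses that are neither f- nor s-houses. -/
abbrev KeptHouse := {h : H // h ∉ I.evenRstar M₁}

/-- The number of dummy agents, which makes the two sides of the reduced graph equally large.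
(The subtraction truncates to `0` if there are more agents than kept houses.) -/
noncomputable def numDummies : ℕ := Nat.card (I.KeptHouse M₁) - Nat.card A

/-- The set `D` of dummy agents. -/
abbrev Dummy : Type := Fin (I.numDummies M₁)

/-- The edges between agents and houses in the reduced graph: the first-choice edges of the
decomposition (unreachable to unreachable, odd agent to even house, even agent to odd house)
and the edges from an even agent `a` to the houses in `s(a)`. -/
def ReducedEdge (a : A) (h : H) : Prop :=
  (h ∈ I.firstChoices a ∧
    ((a ∈ I.unreachableL M₁ ∧ h ∈ I.unreachableR M₁) ∨
      (a ∈ I.oddL M₁ ∧ h ∈ I.evenR M₁) ∨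
      (a ∈ I.evenL M₁ ∧ h ∈ I.oddR M₁))) ∨
  (a ∈ I.evenL M₁ ∧ h ∈ I.secondChoices M₁ a)

/-- The reduced graph `G'`. On the left are the agents and the dummy agents, on the right the kept
houses; dummy agents are joined to all even f-houses and even s-houses. -/
def reducedGraph : SimpleGraph ((A ⊕ I.Dummy M₁) ⊕ I.KeptHouse M₁) :=
  bipartiteGraph fun x h =>
    match x with
    | Sum.inl a => I.ReducedEdge M₁ a h.1
    | Sum.inr _ => h.1 ∈ I.evenRf M₁ ∪ I.evenRfs M₁ ∪ I.evenRs M₁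

end Reduction

end HAT

noncomputable def numPerfectMatchings {V : Type*} (G : SimpleGraph V) : ℕ :=
  Nat.card {M : G.Subgraph // M.IsPerfectMatching}

/-!
An assignment is a matching that covers all agents, that is, an injective map `m` from agents to
listed houses. With last-resort houses every popular matching is an assignment
(`exists_matchingOf_eq`), and dropping the last-resort houses identifies assignments with the
matchings of the original instance, preferences included (`prefers_properMatching`). Hence both
instances have as many popular matchings as there are popular assignments.

The popular assignments are those that follow the edges of the reduced graph and use every house
which is not even.

For one direction, suppose that `m` is popular and that `a` does not get a first choice. No house
`h` that an even alternating path, relative to the first-choice edges of `m`, links to a house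
without such an edge can be better for `a` than `m a` (`rank_le_of_mem_evenVerts`). Otherwise,
exchanging the edges along the path frees `h` for `a` at the cost of displacing at most one agent
`b`; moving `b` to a first choice, whose owner retires to a private house, gives an assignment with
two winners and one loser (`not_isPopularAssignment_of_switch`). Applied to first choices of `a`,
this says that the first-choice edges of `m` cannot be augmented, so they form a maximum matching of
the first-choice graph. Applied to `s(a)`, it says that `a` gets a house of `s(a)`. The structure of
maximum matchings does the rest: in a bipartite graph the vertices of one side that are not even,
together with the odd vertices of the other side, form a vertex cover as large as a maximum matching
(`ncard_edgeSet_le_of_forall_evenVerts`), so every maximum matching covers all vertices that are not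
even and matches odd vertices to even ones, and the even vertices are the same for all of them.

For the other direction (`isPopularAssignment_of_reducedEdge`), whoever prefers another assignment
`n` to `m` gets from `n` a house of the set `T` of houses that are not even. As `m` fills `T` with
agents at their first choices, each of the houses of `T` taken in this way drives one of these
agents out of `T`, to a house worse than a first choice.

A perfect matching of the reduced graph therefore consists of a popular assignment and a bijection
from the dummy agents to the unused kept houses. Two such bijections differ by a permutation of the
dummy agents, whence the factorial.
-/

/-! ### Alternating paths in a two-coloured graph -/

section Alternating

open SimpleGraph

variable {V : Type*} {G : SimpleGraph V}

/-- The edges of `G'` as a subgraph of `G`, on the vertices that such an edge meets. -/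
def subgraphOfLE (G' : SimpleGraph V) (h : G' ≤ G) : G.Subgraph where
  verts := G'.support
  Adj := G'.Adj
  adj_sub h' := h h'
  edge_vert h' := ⟨_, h'⟩
  symm := G'.symm

lemma subgraphOfLE_isMatching {G' : SimpleGraph V} {h : G' ≤ G}
    (hu : ∀ u v w, G'.Adj u v → G'.Adj u w → v = w) : (subgraphOfLE G' h).IsMatching :=
  fun v ⟨w, hw⟩ => ⟨w, hw, fun x hx => hu v x w hx hw⟩

lemma isMatching_ext {M N : G.Subgraph} (hM : M.IsMatching) (hN : N.IsMatching)
    (h : ∀ v w, M.Adj v w ↔ N.Adj v w) : M = N := by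
  refine Subgraph.ext ?_ (by ext v w; exact h v w)
  rw [← hM.support_eq_verts, ← hN.support_eq_verts]
  ext v
  simp [Subgraph.mem_support, h]

/-- An alternating list of edges whose first edge is not in `M` has its edges of `M` at the even
places. -/
lemma alternating_getLast {M : G.Subgraph} (l : List (Sym2 V))
    (hl : l.IsChain (fun e e' => (e ∈ M.edgeSet ↔ e' ∉ M.edgeSet)))
    (h0 : ∀ e ∈ l.head?, e ∉ M.edgeSet) :
    ∀ e ∈ l.getLast?, (e ∈ M.edgeSet ↔ Even l.length) := by
  induction l using List.reverseRecOn with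
  | nil => simp
  | append_singleton l e ih =>
    rw [List.isChain_append] at hl
    obtain ⟨h1, -, h3⟩ := hl
    rcases List.eq_nil_or_concat l with rfl | ⟨l', e', rfl⟩
    · simpa using h0
    · rw [List.concat_eq_append] at *
      have hh : ∀ x ∈ (l' ++ [e']).head?, x ∉ M.edgeSet := by
        intro x hx
        apply h0
        rw [List.head?_append]
        simp_all
      have h4 := ih h1 hh e' (by simp)
      have h5 := h3 e' (by simp) e (by simp)
      intro x hx
      obtain rfl : e = x := by simpa using hx
      simp only [List.length_append, List.length_singleton, Nat.even_add_one] at h4 ⊢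
      tauto

/-- The first edge of a walk that starts at an unmatched vertex is not in the matching. -/
lemma head?_edges_notMem {M : G.Subgraph} {u v : V} (hu : u ∉ M.support) (p : G.Walk u v) :
    ∀ e ∈ p.edges.head?, e ∉ M.edgeSet := by
  cases p with
  | nil => simp
  | cons h q =>
    intro e he hm
    obtain rfl : s(u, _) = e := by simpa using he
    exact hu ⟨_, Subgraph.mem_edgeSet.1 hm⟩

lemma IsAlternatingPath.takeUntil [DecidableEq V] {M : G.Subgraph} {u v w : V} {p : G.Walk u v}
    (hp : IsAlternatingPath M p) (hw : w ∈ p.support) :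
    IsAlternatingPath M (p.takeUntil w hw) := by
  refine ⟨hp.1.takeUntil hw, ?_⟩
  have h := hp.2
  rw [← p.take_spec hw, Walk.edges_append, List.isChain_append] at h
  exact h.1

lemma IsAlternatingPath.concat {M : G.Subgraph} {u v w : V} {p : G.Walk u v}
    (hp : IsAlternatingPath M p) (hu : u ∉ M.support) (hw : w ∉ p.support) (h : G.Adj v w)
    (hM : M.Adj v w ↔ Odd p.length) : IsAlternatingPath M (p.concat h) := by
  refine ⟨hp.1.concat hw h, ?_⟩
  rw [Walk.edges_concat, List.concat_eq_append, List.isChain_append]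
  refine ⟨hp.2, by simp, fun e he e' he' => ?_⟩
  obtain rfl : s(v, w) = e' := by simpa using he'
  rw [alternating_getLast _ hp.2 (head?_edges_notMem hu p) e he, Walk.length_edges,
    Subgraph.mem_edgeSet, hM, Nat.not_odd_iff_even]

lemma mem_evenVerts_of_notMem_support {M : G.Subgraph} {u : V} (hu : u ∉ M.support) :
    u ∈ evenVerts M :=
  ⟨u, hu, .nil, ⟨by simp, by simp⟩, by simp⟩

lemma mem_oddVerts_of_adj (c : G.Coloring Bool) {M : G.Subgraph} (hM : M.IsMatching) {v w : V}
    (hv : v ∈ evenVerts M) (h : G.Adj v w) : w ∈ oddVerts M := by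
  classical
  obtain ⟨u, hu, p, hp, hev⟩ := hv
  have hc := c.valid h
  have hpar := (c.even_length_iff_congr p).1 hev
  refine ⟨u, hu, ?_⟩
  by_cases hw : w ∈ p.support
  · refine ⟨_, hp.takeUntil hw, ?_⟩
    rw [← Nat.not_even_iff_odd, c.even_length_iff_congr]
    grind
  · refine ⟨_, hp.concat hu hw h ?_, by rw [Walk.length_concat]; exact hev.add_one⟩
    -- The `M`-partner of `v`, if any, precedes `v` on the path, so `w` is not it.
    refine ⟨fun hvw => ?_, fun ho => absurd hev (Nat.not_even_iff_odd.2 ho)⟩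
    exfalso
    rcases p with _ | ⟨h', q⟩
    · exact hu ⟨_, hvw⟩
    · obtain ⟨x, q', h'', he⟩ := Walk.exists_cons_eq_concat h' q
      rw [he] at hp hev hw
      have := (alternating_getLast _ hp.2 (head?_edges_notMem hu _) s(x, v)
        (by simp [Walk.edges_concat])).2 (by rwa [Walk.length_edges])
      have hxw := hM.eq_of_adj_left (Subgraph.mem_edgeSet.1 this).symm hvw
      subst hxw
      exact hw (by simp [Walk.support_concat])

lemma mem_evenVerts_of_adj (c : G.Coloring Bool) {M : G.Subgraph} {v w : V}
    (hv : v ∈ oddVerts M) (h : M.Adj v w) : w ∈ evenVerts M := by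
  classical
  obtain ⟨u, hu, p, hp, hodd⟩ := hv
  have hc := c.valid h.adj_sub
  have hpar := mt (c.even_length_iff_congr p).2 (Nat.not_even_iff_odd.2 hodd)
  refine ⟨u, hu, ?_⟩
  by_cases hw : w ∈ p.support
  · refine ⟨_, hp.takeUntil hw, ?_⟩
    rw [c.even_length_iff_congr]
    grind
  · exact ⟨_, hp.concat hu hw h.adj_sub (by simp [h, hodd]),
      by rw [Walk.length_concat]; exact hodd.add_one⟩

/-- Induction along alternating paths: `P` and `Q` are propagated to the vertices at even and at
odd distance from the unmatched end. -/
lemma alternating_induction {M : G.Subgraph} {P Q : V → Prop} (hP0 : ∀ u ∉ M.support, P u)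
    (hPQ : ∀ x y, P x → G.Adj x y → Q y) (hQP : ∀ x y, Q x → M.Adj x y → P y) :
    (∀ v ∈ evenVerts M, P v) ∧ ∀ v ∈ oddVerts M, Q v := by
  have aux : ∀ {x v : V} (p : G.Walk x v),
      p.edges.IsChain (fun e e' => (e ∈ M.edgeSet ↔ e' ∉ M.edgeSet)) →
      (P x → (∀ e ∈ p.edges.head?, e ∉ M.edgeSet) →
        (Even p.length → P v) ∧ (Odd p.length → Q v)) ∧
      (Q x → (∀ e ∈ p.edges.head?, e ∈ M.edgeSet) →
        (Even p.length → Q v) ∧ (Odd p.length → P v)) := by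
    intro x v p
    induction p with
    | nil => intro _; simp +contextual
    | @cons a b d h q ih =>
      intro hch
      rw [Walk.edges_cons, List.isChain_cons] at hch
      obtain ⟨ih1, ih2⟩ := ih hch.2
      simp only [Walk.edges_cons, List.head?_cons, Option.mem_def, Option.some.injEq,
        forall_eq', Walk.length_cons, Nat.even_add_one, Nat.odd_add_one, Nat.not_even_iff_odd,
        Nat.not_odd_iff_even]
      refine ⟨fun hp hm => ?_, fun hq hm => ?_⟩
      · have := ih2 (hPQ _ _ hp h) (fun e he => by have := hch.1 e he; tauto)
        exact ⟨this.2, this.1⟩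
      · have := ih1 (hQP _ _ hq (Subgraph.mem_edgeSet.1 hm))
          (fun e he => by have := hch.1 e he; tauto)
        exact ⟨this.2, this.1⟩
  refine ⟨fun v ⟨u, hu, p, hp, he⟩ => ?_, fun v ⟨u, hu, p, hp, he⟩ => ?_⟩
  · exact ((aux p hp.2).1 (hP0 u hu) (head?_edges_notMem hu p)).1 he
  · exact ((aux p hp.2).1 (hP0 u hu) (head?_edges_notMem hu p)).2 he

lemma exists_evenVerts_adj (c : G.Coloring Bool) {M : G.Subgraph} {w : V}
    (hw : w ∈ oddVerts M) : ∃ v ∈ evenVerts M, G.Adj v w := by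
  classical
  obtain ⟨u, hu, p, hp, ho⟩ := hw
  rcases p with _ | ⟨h', q⟩
  · simp at ho
  · obtain ⟨x, q', h'', he⟩ := Walk.exists_cons_eq_concat h' q
    rw [he] at hp ho
    have hx : x ∈ (q'.concat h'').support := by simp [Walk.support_concat]
    refine ⟨x, ⟨u, hu, _, hp.takeUntil hx, ?_⟩, h''⟩
    have hc := c.valid h''
    have hpar := mt (c.even_length_iff_congr _).2 (Nat.not_even_iff_odd.2 ho)
    rw [c.even_length_iff_congr]
    grind

/-- Exchanging the edges along an even alternating path from an unmatched vertex `u` to `v` gives a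
matching that covers `u` in the place of `v`. -/
lemma exists_isMatching_switch : ∀ (n : ℕ) {M : G.Subgraph}, M.IsMatching →
    ∀ {u v : V}, u ∉ M.support → ∀ p : G.Walk u v, IsAlternatingPath M p → p.length = 2 * n →
    ∃ N : G.Subgraph, N.IsMatching ∧ N.support = insert u M.support \ {v} := by
  intro n
  induction n with
  | zero =>
    intro M hM u v hu p hp hl
    obtain rfl := Walk.eq_of_length_eq_zero (by simpa using hl)
    exact ⟨M, hM, by simp [hu]⟩
  | succ n ih =>
    intro M hM u v hu p hp hl
    rcases p with _ | @⟨_, x, _, hux, _ | @⟨_, y, _, hxy, q⟩⟩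
    · simp at hl
    · simp at hl; omega
    obtain ⟨hpath, hch⟩ := hp
    simp only [Walk.cons_isPath_iff, Walk.support_cons, List.mem_cons, not_or] at hpath
    obtain ⟨⟨hq, hxq⟩, hux', huq⟩ := hpath
    simp only [Walk.edges_cons, List.isChain_cons_cons] at hch
    have hMux : s(u, x) ∉ M.edgeSet := fun hm => hu ⟨x, Subgraph.mem_edgeSet.1 hm⟩
    have hMxy : M.Adj x y := by
      have := hch.1
      rw [Subgraph.mem_edgeSet] at hMux
      simp only [Subgraph.mem_edgeSet] at this
      tauto
    have huy : u ≠ y := fun h => huq (h ▸ q.start_mem_support)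
    -- The matching in which `x` leaves its partner `y` for `u`.
    let G' : SimpleGraph V :=
      { Adj := fun a b => (a = u ∧ b = x) ∨ (a = x ∧ b = u) ∨ (M.Adj a b ∧ a ≠ x ∧ b ≠ x)
        symm := ⟨fun a b h => by
          rcases h with h | h | h
          · exact Or.inr (Or.inl ⟨h.2, h.1⟩)
          · exact Or.inl ⟨h.2, h.1⟩
          · exact Or.inr (Or.inr ⟨h.1.symm, h.2.2, h.2.1⟩)⟩
        loopless := ⟨fun a h => by
          rcases h with h | h | h
          · exact hux' (h.1.symm.trans h.2)
          · exact hux' (h.2.symm.trans h.1)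
          · exact h.1.ne rfl⟩ }
    have hG' : G' ≤ G := by
      intro a b h
      rcases h with ⟨rfl, rfl⟩ | ⟨rfl, rfl⟩ | h
      · exact hux
      · exact hux.symm
      · exact h.1.adj_sub
    have huM : ∀ z, ¬ M.Adj u z := fun z hz => hu ⟨z, hz⟩
    have hM2 : (subgraphOfLE G' hG').IsMatching := by
      apply subgraphOfLE_isMatching
      intro a b d hab had
      rcases hab with hab | hab | hab <;> rcases had with had | had | had
      all_goals first
        | exact hM.eq_of_adj_left hab.1 had.1
        | grind
    have hsupp : (subgraphOfLE G' hG').support = insert u M.support \ {y} := by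
      ext a
      simp only [Subgraph.mem_support, Set.mem_sdiff, Set.mem_insert_iff, Set.mem_singleton_iff]
      constructor
      · rintro ⟨b, ⟨rfl, rfl⟩ | ⟨rfl, rfl⟩ | ⟨h, h1, h2⟩⟩
        · exact ⟨Or.inl rfl, huy⟩
        · exact ⟨Or.inr ⟨y, hMxy⟩, hMxy.ne⟩
        · refine ⟨Or.inr ⟨b, h⟩, ?_⟩
          rintro rfl
          exact h2 (hM.eq_of_adj_left h hMxy.symm)
      · rintro ⟨rfl | ⟨b, hb⟩, hay⟩
        · exact ⟨x, Or.inl ⟨rfl, rfl⟩⟩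
        · by_cases hax : a = x
          · exact ⟨u, Or.inr (Or.inl ⟨hax, rfl⟩)⟩
          · refine ⟨b, Or.inr (Or.inr ⟨hb, hax, ?_⟩)⟩
            rintro rfl
            exact hay (hM.eq_of_adj_left hb.symm hMxy)
    have hy : y ∉ (subgraphOfLE G' hG').support := by simp [hsupp]
    -- The remaining path avoids `u` and `x`, where alone the two matchings differ.
    have hedge : ∀ e ∈ q.edges, (e ∈ (subgraphOfLE G' hG').edgeSet ↔ e ∈ M.edgeSet) := by
      intro e he
      induction e using Sym2.ind with
      | _ a b =>
        have ha := q.fst_mem_support_of_mem_edges he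
        have hb := q.snd_mem_support_of_mem_edges he
        have h1 : a ≠ u := fun h => huq (h ▸ ha)
        have h2 : a ≠ x := fun h => hxq (h ▸ ha)
        have h3 : b ≠ x := fun h => hxq (h ▸ hb)
        simp only [Subgraph.mem_edgeSet]
        change (_ ∨ _ ∨ _) ↔ _
        tauto
    have hq' : IsAlternatingPath (subgraphOfLE G' hG') q := by
      refine ⟨hq, ?_⟩
      have := hch.2.tail
      refine List.IsChain.imp_of_mem_imp ?_ this
      intro a b ha hb hab
      rw [hedge a ha, hedge b hb]
      exact hab
    obtain ⟨N, hN, hNs⟩ := ih hM2 hy q hq' (by simp at hl; omega)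
    refine ⟨N, hN, ?_⟩
    rw [hNs, hsupp]
    congr 1
    rw [Set.insert_sdiff_singleton, Set.insert_eq_of_mem]
    exact Or.inr ⟨x, hMxy.symm⟩

lemma exists_isMatching_of_mem_evenVerts {M : G.Subgraph} (hM : M.IsMatching) {v : V}
    (hv : v ∈ evenVerts M) : ∃ u ∉ M.support, (∃ p : G.Walk u v, Even p.length) ∧
      ∃ N : G.Subgraph, N.IsMatching ∧ N.support = insert u M.support \ {v} := by
  obtain ⟨u, hu, p, hp, he⟩ := hv
  obtain ⟨n, hn⟩ := he
  exact ⟨u, hu, ⟨p, n, hn⟩, exists_isMatching_switch n hM hu p hp (by omega)⟩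

end Alternating

/-! ### The decomposition given by a maximum matching -/

section Decomposition

open SimpleGraph

variable {V : Type*} {G : SimpleGraph V}

lemma color_eq_of_adj (c : G.Coloring Bool) {b : Bool} {v w : V} (h : G.Adj v w) (hw : c w ≠ b) :
    c v = b := by
  have := c.valid h
  revert this hw
  cases c v <;> cases c w <;> cases b <;> simp

lemma mem_unreachableVerts {M : G.Subgraph} {v : V} :
    v ∈ unreachableVerts M ↔ v ∉ evenVerts M ∧ v ∉ oddVerts M := by
  constructor
  · exact fun h => ⟨fun ⟨u, hu, p, hp, _⟩ => h u hu p hp, fun ⟨u, hu, p, hp, _⟩ => h u hu p hp⟩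
  · rintro ⟨h1, h2⟩ u hu p hp
    rcases Nat.even_or_odd p.length with h | h
    · exact h1 ⟨u, hu, p, hp, h⟩
    · exact h2 ⟨u, hu, p, hp, h⟩

lemma SimpleGraph.Subgraph.IsMatching.ncard_le [Finite V] {M : G.Subgraph} (hM : M.IsMatching)
    {P Q : Set V} (h : ∀ v ∈ P, ∃ w ∈ Q, M.Adj v w) : P.ncard ≤ Q.ncard := by
  choose! f hf using h
  refine Set.ncard_le_ncard_of_injOn f (fun a ha => (hf a ha).1) fun a ha b hb hab => ?_
  have h1 := (hf a ha).2
  rw [hab] at h1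
  exact hM.eq_of_adj_right h1 (hf b hb).2

/-- A matching has as many edges as it covers vertices of a given colour. -/
lemma ncard_edgeSet_eq (c : G.Coloring Bool) (b : Bool) {M : G.Subgraph} (hM : M.IsMatching) :
    M.edgeSet.ncard = {v | v ∈ M.support ∧ c v = b}.ncard := by
  have hex : ∀ v ∈ M.support, ∃ w, M.Adj v w := fun v hv => hv
  choose f hf using hex
  symm
  refine Set.ncard_congr (fun v hv => s(v, f v hv.1))
    (fun v hv => Subgraph.mem_edgeSet.2 (hf v hv.1)) ?_ ?_
  · intro v w hv hw h
    rcases Sym2.eq_iff.1 h with h | h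
    · exact h.1
    · exfalso
      have := c.valid (hf v hv.1).adj_sub
      rw [h.2] at this
      exact this (hv.2.trans hw.2.symm)
  · intro e he
    induction e using Sym2.ind with
    | _ x y =>
      rw [Subgraph.mem_edgeSet] at he
      by_cases hx : c x = b
      · refine ⟨x, ⟨⟨y, he⟩, hx⟩, ?_⟩
        rw [hM.eq_of_adj_left (hf x ⟨y, he⟩) he]
      · refine ⟨y, ⟨⟨x, he.symm⟩, color_eq_of_adj c he.adj_sub.symm hx⟩, ?_⟩
        rw [hM.eq_of_adj_left (hf y ⟨x, he.symm⟩) he.symm, Sym2.eq_swap]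

variable [Finite V]

/-- If no even vertex of colour `b` has an unmatched neighbour, then the vertices of colour `b` that
are not even, together with the odd vertices of the other colour, form a vertex cover with as many
vertices as `M` has edges. So `M` is maximum, and every other maximum matching covers these
vertices by pairwise different edges. -/
lemma ncard_edgeSet_le_of_forall_evenVerts (c : G.Coloring Bool) (b : Bool) {M : G.Subgraph}
    (hM : M.IsMatching)
    (hfree : ∀ v ∈ evenVerts M, c v = b → ∀ w, G.Adj v w → w ∈ M.support)
    {N : G.Subgraph} (hN : N.IsMatching) :
    N.edgeSet.ncard ≤ M.edgeSet.ncard ∧ (M.edgeSet.ncard ≤ N.edgeSet.ncard →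
      (∀ v, c v = b → v ∉ evenVerts M → v ∈ N.support) ∧
      ∀ w, c w ≠ b → w ∈ oddVerts M → ∀ v, N.Adj w v → v ∈ evenVerts M) := by
  set T : Set V := {v | c v = b ∧ v ∉ evenVerts M} with hT
  set X : Set V := {w | c w ≠ b ∧ w ∈ oddVerts M} with hX
  have hfin : ∀ s : Set V, s.Finite := fun s => s.toFinite
  have split (K : G.Subgraph) : {v | v ∈ K.support ∧ c v = b}.ncard =
      (T ∩ K.support).ncard + {v | v ∈ K.support ∧ c v = b ∧ v ∈ evenVerts M}.ncard := by
    rw [← Set.ncard_union_eq _ (hfin _) (hfin _)]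
    · congr 1
      ext v
      simp only [hT, Set.mem_union, Set.mem_inter_iff, Set.mem_ofPred_eq]
      tauto
    · rw [Set.disjoint_left]
      rintro v ⟨⟨-, h⟩, -⟩ ⟨-, -, h'⟩
      exact h h'
  have hM1 : T ∩ M.support = T := by
    refine Set.inter_eq_left.2 fun v hv => ?_
    by_contra h
    exact hv.2 (mem_evenVerts_of_notMem_support h)
  have hM2 : X.ncard ≤ {v | v ∈ M.support ∧ c v = b ∧ v ∈ evenVerts M}.ncard := by
    refine hM.ncard_le ?_
    rintro w ⟨hwc, hw⟩
    obtain ⟨v, hv, hvw⟩ := exists_evenVerts_adj c hw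
    obtain ⟨x, hx⟩ := hfree v hv (color_eq_of_adj c hvw hwc) w hvw
    exact ⟨x, ⟨⟨w, hx.symm⟩, color_eq_of_adj c hx.adj_sub.symm hwc,
      mem_evenVerts_of_adj c hw hx⟩, hx⟩
  set X' : Set V := {w | w ∈ X ∧ ∃ v ∈ evenVerts M, N.Adj v w} with hX'
  have hN2 : {v | v ∈ N.support ∧ c v = b ∧ v ∈ evenVerts M}.ncard ≤ X'.ncard := by
    refine hN.ncard_le ?_
    rintro v ⟨⟨w, hw⟩, hvc, hv⟩
    have := c.valid hw.adj_sub
    exact ⟨w, ⟨⟨fun h => this (hvc.trans h.symm), mem_oddVerts_of_adj c hM hv hw.adj_sub⟩,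
      v, hv, hw⟩, hw⟩
  have h1 : (T ∩ N.support).ncard ≤ T.ncard := Set.ncard_le_ncard Set.inter_subset_left (hfin _)
  have hsub : X' ⊆ X := fun w hw => hw.1
  have h2 : X'.ncard ≤ X.ncard := Set.ncard_le_ncard hsub (hfin _)
  rw [ncard_edgeSet_eq c b hM, ncard_edgeSet_eq c b hN, split M, split N, hM1]
  refine ⟨by omega, fun h => ⟨fun v hvc hv => ?_, fun w hwc hw v hwv => ?_⟩⟩
  · have : T ∩ N.support = T :=
      Set.eq_of_subset_of_ncard_le Set.inter_subset_left (by omega) (hfin _)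
    exact (this.symm ▸ (⟨hvc, hv⟩ : v ∈ T) : v ∈ T ∩ N.support).2
  · have : X' = X := Set.eq_of_subset_of_ncard_le hsub (by omega) (hfin _)
    obtain ⟨-, x, hx, hxw⟩ := (this.symm ▸ (⟨hwc, hw⟩ : w ∈ X) : w ∈ X')
    rwa [hN.eq_of_adj_left hwv hxw.symm]

lemma mem_support_of_evenVerts_adj (c : G.Coloring Bool) {M : G.Subgraph}
    (hM : IsMaximumMatching M) {v w : V} (hv : v ∈ evenVerts M) (h : G.Adj v w) :
    w ∈ M.support := by
  by_contra hw
  obtain ⟨u, hu, ⟨p, hp⟩, N, hN, hNs⟩ := exists_isMatching_of_mem_evenVerts hM.1 hv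
  have hc := c.valid h
  have hpar := (c.even_length_iff_congr p).1 hp
  have hvN : v ∉ N.support := by simp [hNs]
  have hwN : w ∉ N.support := by
    rw [hNs]
    rintro ⟨rfl | h', -⟩
    · grind
    · exact hw h'
  have hK : (N ⊔ G.subgraphOfAdj h).IsMatching := by
    refine hN.sup (Subgraph.IsMatching.subgraphOfAdj h) ?_
    rw [Set.disjoint_left, SimpleGraph.support_subgraphOfAdj]
    rintro x hx (rfl | rfl)
    · exact hvN hx
    · exact hwN hx
  have h1 := hM.2 _ hK
  -- The colour of `w`, which neither `u` nor `v` has, is the convenient one for counting edges.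
  rw [ncard_edgeSet_eq c (c w) hK, ncard_edgeSet_eq c (c w) hM.1] at h1
  have h2 : insert w {x | x ∈ M.support ∧ c x = c w} ⊆
      {x | x ∈ (N ⊔ G.subgraphOfAdj h).support ∧ c x = c w} := by
    rintro x (rfl | ⟨hx, hxc⟩)
    · exact ⟨⟨v, Or.inr (by simp [Sym2.eq_swap])⟩, rfl⟩
    · have : x ∈ N.support := by
        rw [hNs]
        exact ⟨Or.inr hx, by rintro rfl; exact hc hxc⟩
      obtain ⟨y, hy⟩ := this
      exact ⟨⟨y, Or.inl hy⟩, hxc⟩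
  have h3 := Set.ncard_le_ncard h2 (Set.toFinite _)
  rw [Set.ncard_insert_of_notMem (fun h => hw h.1) (Set.toFinite _)] at h3
  omega

lemma isMaximumMatching_of_forall_evenVerts (c : G.Coloring Bool) (b : Bool) {M : G.Subgraph}
    (hM : M.IsMatching)
    (hfree : ∀ v ∈ evenVerts M, c v = b → ∀ w, G.Adj v w → w ∈ M.support) :
    IsMaximumMatching M :=
  ⟨hM, fun _ hN => (ncard_edgeSet_le_of_forall_evenVerts c b hM hfree hN).1⟩

lemma mem_support_of_notMem_evenVerts (c : G.Coloring Bool) {M N : G.Subgraph}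
    (hM : IsMaximumMatching M) (hN : IsMaximumMatching N) {v : V} (hv : v ∉ evenVerts M) :
    v ∈ N.support :=
  ((ncard_edgeSet_le_of_forall_evenVerts c (c v) hM.1
    (fun _ hx _ _ hxy => mem_support_of_evenVerts_adj c hM hx hxy) hN.1).2 (hN.2 _ hM.1)).1
      v rfl hv

lemma mem_evenVerts_of_oddVerts_adj (c : G.Coloring Bool) {M N : G.Subgraph}
    (hM : IsMaximumMatching M) (hN : IsMaximumMatching N) {v w : V} (hw : w ∈ oddVerts M)
    (h : N.Adj w v) : v ∈ evenVerts M :=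
  ((ncard_edgeSet_le_of_forall_evenVerts c (!c w) hM.1
    (fun _ hx _ _ hxy => mem_support_of_evenVerts_adj c hM hx hxy) hN.1).2 (hN.2 _ hM.1)).2
      w (by simp) hw v h

lemma notMem_oddVerts_of_mem_evenVerts (c : G.Coloring Bool) {M : G.Subgraph}
    (hM : IsMaximumMatching M) {v : V} (hv : v ∈ evenVerts M) : v ∉ oddVerts M := by
  refine (alternating_induction (P := (· ∉ oddVerts M)) (Q := (· ∉ evenVerts M)) ?_ ?_ ?_).1 v hv
  · intro u hu ho
    obtain ⟨x, hx, hxu⟩ := exists_evenVerts_adj c ho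
    exact hu (mem_support_of_evenVerts_adj c hM hx hxu)
  · exact fun x y hx hxy hy => hx (mem_oddVerts_of_adj c hM.1 hy hxy.symm)
  · exact fun x y hx hxy hy => hx (mem_evenVerts_of_adj c hy hxy.symm)

/-- Even vertices are those that some maximum matching misses; so they do not depend on the
maximum matching. -/
lemma evenVerts_subset (c : G.Coloring Bool) {M N : G.Subgraph}
    (hM : IsMaximumMatching M) (hN : IsMaximumMatching N) : evenVerts M ⊆ evenVerts N := by
  intro v hv
  by_contra hvN
  obtain ⟨u, hu, ⟨p, hp⟩, K, hK, hKs⟩ := exists_isMatching_of_mem_evenVerts hM.1 hv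
  have hpar := (c.even_length_iff_congr p).1 hp
  have hKM : IsMaximumMatching K := by
    refine ⟨hK, fun L hL => (hM.2 L hL).trans ?_⟩
    -- On the side opposite to `v` (and `u`) the two matchings cover the same vertices.
    rw [ncard_edgeSet_eq c (!c v) hM.1, ncard_edgeSet_eq c (!c v) hK]
    refine Set.ncard_le_ncard (fun x hx => ⟨?_, hx.2⟩) (Set.toFinite _)
    rw [hKs]
    refine ⟨Or.inr hx.1, ?_⟩
    rintro rfl
    simpa using hx.2
  have := mem_support_of_notMem_evenVerts c hN hKM hvN
  simp [hKs] at this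

end Decomposition

/-! ### Bipartite graphs -/

section Bipartite

open SimpleGraph

variable {L R : Type*}

lemma bipartiteGraph_mono {r q : L → R → Prop} (h : ∀ x y, q x y → r x y) :
    bipartiteGraph q ≤ bipartiteGraph r := by
  rintro (x | x) (y | y) hxy
  · exact hxy
  · exact h _ _ hxy
  · exact h _ _ hxy
  · exact hxy

/-- The two-colouring of a bipartite graph by its sides; left vertices have the colour `true`. -/
def bipartiteColoring (r : L → R → Prop) : (bipartiteGraph r).Coloring Bool :=
  Coloring.mk Sum.isLeft (by rintro (x | x) (y | y) h <;> first | exact h.elim | simp)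

lemma isMatching_bipartite {r q : L → R → Prop} (h : ∀ x y, q x y → r x y)
    (hl : ∀ x y y', q x y → q x y' → y = y') (hr : ∀ x x' y, q x y → q x' y → x = x') :
    (subgraphOfLE (bipartiteGraph q) (bipartiteGraph_mono h)).IsMatching := by
  apply subgraphOfLE_isMatching
  rintro (x | x) (y | y) (z | z) h1 h2
  all_goals first
    | exact h1.elim
    | exact h2.elim
    | exact congrArg _ (hl _ _ _ h1 h2)
    | exact congrArg _ (hr _ _ _ h1 h2)

end Bipartite

/-! ### Popular assignments -/

namespace HAT

open SimpleGraph

variable {A H : Type*}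

/-- A matching in which every agent `a` is matched, to the house `m a`. -/
def IsAssignment (J : HAT A H) (m : A → H) : Prop :=
  Function.Injective m ∧ ∀ a, m a ∈ J.list a

/-- An assignment that beats or ties every other assignment in the vote. -/
def IsPopularAssignment (J : HAT A H) (m : A → H) : Prop :=
  J.IsAssignment m ∧ ∀ n, J.IsAssignment n →
    {a | J.rank a (n a) < J.rank a (m a)}.ncard ≤ {a | J.rank a (m a) < J.rank a (n a)}.ncard

/-- Every agent lists a house that no other agent lists. -/
def HasPrivateHouses (J : HAT A H) : Prop :=
  ∀ a, ∃ l ∈ J.list a, ∀ b, l ∈ J.list b → b = a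

/-- The first-choice edges of an assignment. -/
def firstPart (J : HAT A H) (m : A → H) : J.firstChoiceGraph.Subgraph :=
  subgraphOfLE (bipartiteGraph fun a h => m a = h ∧ h ∈ J.firstChoices a)
    (bipartiteGraph_mono fun _ _ h => h.2)

variable {J : HAT A H} {m : A → H}

lemma firstPart_adj {a : A} {h : H} :
    (J.firstPart m).Adj (Sum.inl a) (Sum.inr h) ↔ m a = h ∧ h ∈ J.firstChoices a :=
  Iff.rfl

lemma firstPart_isMatching (hm : Function.Injective m) : (J.firstPart m).IsMatching :=
  isMatching_bipartite (fun _ _ h => h.2) (fun _ _ _ h h' => h.1.symm.trans h'.1)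
    fun _ _ _ h h' => hm (h.1.trans h'.1.symm)

lemma inl_mem_firstPart {a : A} :
    Sum.inl a ∈ (J.firstPart m).support ↔ m a ∈ J.firstChoices a := by
  constructor
  · rintro ⟨x | x, hx⟩
    · exact hx.elim
    · obtain ⟨rfl, hx⟩ := firstPart_adj.1 hx
      exact hx
  · exact fun h => ⟨Sum.inr (m a), firstPart_adj.2 ⟨rfl, h⟩⟩

lemma inr_mem_firstPart {h : H} :
    Sum.inr h ∈ (J.firstPart m).support ↔ ∃ a, m a ∈ J.firstChoices a ∧ m a = h := by
  constructor
  · rintro ⟨x | x, hx⟩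
    · obtain ⟨rfl, hx⟩ := firstPart_adj.1 hx.symm
      exact ⟨x, hx, rfl⟩
    · exact hx.elim
  · rintro ⟨a, ha, rfl⟩
    exact ⟨Sum.inl a, (firstPart_adj.2 ⟨rfl, ha⟩).symm⟩

lemma firstChoices_nonempty {a : A} {h : H} (hh : h ∈ J.list a) : (J.firstChoices a).Nonempty := by
  obtain ⟨x, hx, hx'⟩ := exists_minimalFor_of_wellFoundedLT (· ∈ J.list a) (J.rank a) ⟨h, hh⟩
  refine ⟨x, hx, fun y hy => ?_⟩
  by_contra hlt
  exact hlt (hx' hy (not_le.1 hlt).le)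

variable [Finite A]

lemma not_isPopularAssignment_of_le {n : A → H} (hn : J.IsAssignment n)
    (hle : ∀ c, J.rank c (n c) ≤ J.rank c (m c)) {a : A} (ha : J.rank a (n a) < J.rank a (m a)) :
    ¬ J.IsPopularAssignment m := by
  intro hm
  have h1 := hm.2 n hn
  have h2 : {a | J.rank a (m a) < J.rank a (n a)} = ∅ := by
    ext c
    simpa using hle c
  rw [h2, Set.ncard_empty, Nat.le_zero, Set.ncard_eq_zero (Set.toFinite _)] at h1
  exact (h1 ▸ (ha : a ∈ {a | J.rank a (n a) < J.rank a (m a)}) : a ∈ (∅ : Set A))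

lemma not_isPopularAssignment_of_pair {n : A → H} (hn : J.IsAssignment n) {a b c : A}
    (hle : ∀ d ≠ c, J.rank d (n d) ≤ J.rank d (m d)) (hab : a ≠ b)
    (ha : J.rank a (n a) < J.rank a (m a)) (hb : J.rank b (n b) < J.rank b (m b)) :
    ¬ J.IsPopularAssignment m := by
  intro hm
  have h1 := hm.2 n hn
  have h2 : {a | J.rank a (m a) < J.rank a (n a)}.ncard ≤ 1 := by
    rw [← Set.ncard_singleton c]
    refine Set.ncard_le_ncard (fun d hd => ?_) (Set.toFinite _)
    by_contra hdc
    exact absurd (hle d hdc) (not_le.2 hd)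
  have h3 : 2 ≤ {a | J.rank a (n a) < J.rank a (m a)}.ncard := by
    rw [← Set.ncard_pair hab]
    refine Set.ncard_le_ncard ?_ (Set.toFinite _)
    rintro d (rfl | rfl)
    · exact ha
    · exact hb
  omega

/-- If the agents that `m` gives a first choice can be given other first choices `n`, so that a
house `h` becomes free and at most one other house `u` is newly used, then nobody without a first
choice may prefer `h` to the house that `m` assigns. For let `a` have `h`. The only agent who may
lose a house is the one, `b`, that `m` assigns `u` as a lower choice. Give `b` a first choice; if
some agent other than `a` had that house, that agent moves to a private house, and `a` and `b`
outvote this agent; if `a` had it, `a` returns to the house assigned by `m`, and `b` alone has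
changed rank. -/
lemma not_isPopularAssignment_of_switch (hp : J.HasPrivateHouses) (hm : J.IsAssignment m)
    {a : A} {h : H} (ha : m a ∉ J.firstChoices a) (hh : h ∈ J.list a)
    (hr : J.rank a h < J.rank a (m a)) {n : A → H} {u : H}
    (hinj : ∀ b c, m b ∈ J.firstChoices b → m c ∈ J.firstChoices c → n b = n c → b = c)
    (hf : ∀ b, m b ∈ J.firstChoices b → n b ∈ J.firstChoices b)
    (hne : ∀ b, m b ∈ J.firstChoices b → n b ≠ h)
    (himg : ∀ b, m b ∈ J.firstChoices b →
      n b = u ∨ ∃ b', m b' ∈ J.firstChoices b' ∧ m b' = n b)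
    (hh' : h = u ∨ ∃ b, m b ∈ J.firstChoices b ∧ m b = h) : ¬ J.IsPopularAssignment m := by
  classical
  have hmi : ∀ b c, m b = m c → b = c := fun b c h => hm.1 h
  set m' : A → H := fun b => if m b ∈ J.firstChoices b then n b else if b = a then h else m b
    with hm'
  have hm'F : ∀ b, m b ∈ J.firstChoices b → m' b = n b := fun b hb => by simp [hm', hb]
  have hm'a : m' a = h := by simp [hm', ha]
  have hm'o : ∀ b, m b ∉ J.firstChoices b → b ≠ a → m' b = m b :=
    fun b hb hba => by simp [hm', hb, hba]
  have hlist : ∀ b, m' b ∈ J.list b := by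
    intro b
    by_cases hb : m b ∈ J.firstChoices b
    · rw [hm'F b hb]
      exact (hf b hb).1
    · by_cases hba : b = a
      · rw [hba, hm'a]
        exact hh
      · rw [hm'o b hb hba]
        exact hm.2 b
  have hle : ∀ b, J.rank b (m' b) ≤ J.rank b (m b) := by
    intro b
    by_cases hb : m b ∈ J.firstChoices b
    · rw [hm'F b hb]
      exact (hf b hb).2 _ (hm.2 b)
    · by_cases hba : b = a
      · rw [hba, hm'a]
        exact hr.le
      · rw [hm'o b hb hba]
  have ham : J.rank a (m' a) < J.rank a (m a) := by rwa [hm'a]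
  -- The only possible conflict in `m'` is about the house `u`.
  have hconf : ∀ c d, m' c = m' d → c ≠ d →
      (m c ∉ J.firstChoices c ∧ c ≠ a ∧ m c = u) ∨ (m d ∉ J.firstChoices d ∧ d ≠ a ∧ m d = u) := by
    intro c d hcd hne'
    by_cases hc : m c ∈ J.firstChoices c <;> by_cases hd : m d ∈ J.firstChoices d <;>
      by_cases hca : c = a <;> by_cases hda : d = a <;> grind
  by_cases hb : ∃ b, m b ∉ J.firstChoices b ∧ b ≠ a ∧ m b = u
  swap
  · refine not_isPopularAssignment_of_le (n := m') ⟨fun c d hcd => ?_, hlist⟩ hle ham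
    by_contra hne'
    rcases hconf c d hcd hne' with h | h
    · exact hb ⟨c, h⟩
    · exact hb ⟨d, h⟩
  obtain ⟨b, hbf, hba, hbu⟩ := hb
  have hinj' : ∀ c d, c ≠ b → d ≠ b → m' c = m' d → c = d := by
    intro c d hcb hdb hcd
    by_contra hne'
    rcases hconf c d hcd hne' with h | h
    · exact hcb (hm.1 (h.2.2.trans hbu.symm))
    · exact hdb (hm.1 (h.2.2.trans hbu.symm))
  obtain ⟨g, hg⟩ := firstChoices_nonempty (hm.2 b)
  have hbg : J.rank b g < J.rank b (m b) := by
    by_contra hlt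
    exact hbf ⟨hm.2 b, fun x hx => (not_lt.1 hlt).trans (hg.2 x hx)⟩
  by_cases hc : ∃ c, c ≠ b ∧ m' c = g
  swap
  · refine not_isPopularAssignment_of_le (n := fun c => if c = b then g else m' c) (a := b)
      ⟨fun c d hcd => ?_, fun c => ?_⟩ (fun c => ?_) (by simpa using hbg)
    · grind
    · grind [hg.1]
    · have := hle c
      grind
  obtain ⟨c, hcb, hcg⟩ := hc
  by_cases hca : c = a
  · rw [hca, hm'a] at hcg
    have key : ∀ d, d ≠ a → d ≠ b → m' d ≠ m a := by
      intro d hda hdb h1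
      by_cases hd : m d ∈ J.firstChoices d
      · rw [hm'F d hd] at h1
        rcases himg d hd with h2 | ⟨b', hb', h2⟩
        · exact hba (hm.1 (hbu.trans (h2.symm.trans h1)))
        · have := hm.1 (h2.trans h1)
          exact ha (this ▸ hb')
      · rw [hm'o d hd hda] at h1
        exact hda (hm.1 h1)
    have hga : g ≠ m a := fun h1 => by
      rw [hcg, h1] at hr
      exact hr.false
    have hal := hm.2 a
    refine not_isPopularAssignment_of_le
      (n := fun d => if d = b then g else if d = a then m a else m' d) (a := b)
      ⟨fun d e hde => ?_, fun d => ?_⟩ (fun d => ?_) (by simpa using hbg)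
    · have := hinj' d e
      have := hinj' d a
      have := hinj' a e
      have := key d
      have := key e
      grind
    · grind [hg.1]
    · have := hle d
      grind
  · obtain ⟨l, hl, hl'⟩ := hp c
    have hlm : ∀ d, m' d = l → d = c := fun d hd => hl' d (hd ▸ hlist d)
    have hlg : g = l → b = c := fun hd => hl' b (hd ▸ hg.1)
    refine not_isPopularAssignment_of_pair
      (n := fun d => if d = b then g else if d = c then l else m' d) (a := a) (b := b) (c := c)
      ⟨fun d e hde => ?_, fun d => ?_⟩ (fun d hd => ?_) hba.symm ?_ (by simpa using hbg)
    · have := hinj' d e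
      have := hinj' d c
      have := hinj' c e
      have := hlm d
      have := hlm e
      grind
    · grind [hg.1]
    · have := hle d
      grind
    · grind

/-- Exchanging the edges along an even alternating path between houses makes `h` free, and newly
uses only the unmatched end of the path; so a popular assignment leaves no wish for `h`. -/
lemma rank_le_of_mem_evenVerts (hp : J.HasPrivateHouses) (hm : J.IsPopularAssignment m) {a : A}
    {h : H} (ha : m a ∉ J.firstChoices a) (hh : h ∈ J.list a)
    (he : Sum.inr h ∈ evenVerts (J.firstPart m)) : J.rank a (m a) ≤ J.rank a h := by
  by_contra! hr
  by_cases hs : Sum.inr h ∈ (J.firstPart m).support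
  swap
  · rw [inr_mem_firstPart] at hs
    exact not_isPopularAssignment_of_switch (u := h) hp hm.1 ha hh hr (n := m)
      (fun b c _ _ hbc => hm.1.1 hbc) (fun _ hb => hb) (fun b hb hbh => hs ⟨b, hb, hbh⟩)
      (fun b hb => Or.inr ⟨b, hb, rfl⟩) (Or.inl rfl) hm
  obtain ⟨u, hu, ⟨p, hpe⟩, N, hN, hNs⟩ :=
    exists_isMatching_of_mem_evenVerts (firstPart_isMatching hm.1.1) he
  have hpar := ((bipartiteColoring _).even_length_iff_congr p).1 hpe
  rcases u with u | u
  · exact absurd (hpar.1 rfl) Bool.false_ne_true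
  have hex : ∀ b, m b ∈ J.firstChoices b → ∃ x, N.Adj (Sum.inl b) (Sum.inr x) := by
    intro b hb
    have : Sum.inl b ∈ N.support := by
      rw [hNs]
      exact ⟨Or.inr (inl_mem_firstPart.2 hb), by simp⟩
    obtain ⟨x | x, hx⟩ := this
    · exact hx.adj_sub.elim
    · exact ⟨x, hx⟩
  have hmem : ∀ b x, N.Adj (Sum.inl b) (Sum.inr x) → Sum.inr x ∈ N.support :=
    fun b x hx => ⟨_, hx.symm⟩
  have : Nonempty H := ⟨h⟩
  choose! n hn using hex
  refine not_isPopularAssignment_of_switch (u := u) hp hm.1 ha hh hr (n := n) ?_ ?_ ?_ ?_ ?_ hm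
  · intro b c hb hc hbc
    have h1 := hn b hb
    rw [hbc] at h1
    exact Sum.inl_injective (hN.eq_of_adj_right h1 (hn c hc))
  · exact fun b hb => (hn b hb).adj_sub
  · rintro b hb rfl
    have h1 := hmem _ _ (hn b hb)
    rw [hNs] at h1
    exact h1.2 rfl
  · intro b hb
    have h1 := hmem _ _ (hn b hb)
    rw [hNs] at h1
    rcases h1.1 with h2 | h2
    · exact Or.inl (Sum.inr_injective h2)
    · exact Or.inr (inr_mem_firstPart.1 h2)
  · exact Or.inr (inr_mem_firstPart.1 hs)

end HAT

/-! ### Popular assignments use exactly the edges of the reduced graph -/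

namespace HAT

open SimpleGraph

variable {A H : Type*} {J : HAT A H} {m : A → H} {M₁ : J.firstChoiceGraph.Subgraph}

lemma notMem_evenRstar_of_reducedEdge {a : A} {h : H} (hr : J.ReducedEdge M₁ a h) :
    h ∉ J.evenRstar M₁ := by
  rintro ⟨-, h2⟩
  rcases hr with h | h
  · exact h2 (Or.inl ⟨a, h.1⟩)
  · exact h2 (Or.inr ⟨a, h.2⟩)

variable [Finite A] [Finite H]

lemma isMaximumMatching_firstPart (hp : J.HasPrivateHouses) (hm : J.IsPopularAssignment m) :
    IsMaximumMatching (J.firstPart m) := by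
  refine isMaximumMatching_of_forall_evenVerts (bipartiteColoring _) false
    (firstPart_isMatching hm.1.1) ?_
  rintro (x | h) hv hc (a | y) hadj
  · exact hadj.elim
  · exact absurd hc (Bool.true_eq_false_eq_False)
  · replace hadj : h ∈ J.firstChoices a := hadj
    refine inl_mem_firstPart.2 ?_
    by_contra ha
    have hle := rank_le_of_mem_evenVerts hp hm ha hadj.1 hv
    exact ha ⟨hm.1.2 a, fun x hx => hle.trans (hadj.2 x hx)⟩
  · exact hadj.elim

lemma exists_firstChoices_of_notMem_evenR (hp : J.HasPrivateHouses) (hM₁ : IsMaximumMatching M₁)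
    (hm : J.IsPopularAssignment m) {h : H} (hh : h ∉ J.evenR M₁) :
    ∃ a, m a ∈ J.firstChoices a ∧ m a = h :=
  inr_mem_firstPart.1 (mem_support_of_notMem_evenVerts (bipartiteColoring _) hM₁
    (isMaximumMatching_firstPart hp hm) hh)

lemma reducedEdge_of_isPopularAssignment (hp : J.HasPrivateHouses) (hM₁ : IsMaximumMatching M₁)
    (hm : J.IsPopularAssignment m) (a : A) : J.ReducedEdge M₁ a (m a) := by
  have hF := isMaximumMatching_firstPart hp hm
  have c := bipartiteColoring fun a h => h ∈ J.firstChoices a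
  by_cases ha : m a ∈ J.firstChoices a
  · have hadj : (J.firstPart m).Adj (Sum.inl a) (Sum.inr (m a)) := firstPart_adj.2 ⟨rfl, ha⟩
    refine Or.inl ⟨ha, ?_⟩
    by_cases he : Sum.inl a ∈ evenVerts M₁
    · exact Or.inr (Or.inr ⟨he, mem_oddVerts_of_adj c hM₁.1 he hadj.adj_sub⟩)
    by_cases ho : Sum.inl a ∈ oddVerts M₁
    · exact Or.inr (Or.inl ⟨ho, mem_evenVerts_of_oddVerts_adj c hM₁ hF ho hadj⟩)
    · refine Or.inl ⟨mem_unreachableVerts.2 ⟨he, ho⟩,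
        mem_unreachableVerts.2 ⟨fun h => ?_, fun h => ?_⟩⟩
      · exact ho (mem_oddVerts_of_adj c hM₁.1 h hadj.adj_sub.symm)
      · exact he (mem_evenVerts_of_oddVerts_adj c hM₁ hF h hadj.symm)
  · refine Or.inr ⟨?_, hm.1.2 a, ?_, fun h hh he => ?_⟩
    · by_contra he
      exact ha (inl_mem_firstPart.1 (mem_support_of_notMem_evenVerts c hM₁ hF he))
    · by_contra he
      obtain ⟨b, hb, hba⟩ := exists_firstChoices_of_notMem_evenR hp hM₁ hm he
      exact ha (hm.1.1 hba ▸ hb)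
    · exact rank_le_of_mem_evenVerts hp hm ha hh (evenVerts_subset c hM₁ hF he)

/-- An assignment along reduced edges that uses every house which is not even is popular. Let `T` be
the set of these houses. An agent who prefers another assignment `n` has, in `n`, a house of `T`.
The agents that `m` sends into `T` have first choices, and those among them that `n` does not send
into `T` prefer `m`. Since `m` uses up `T`, there are enough of them. -/
lemma isPopularAssignment_of_reducedEdge (hM₁ : IsMaximumMatching M₁)
    (hm : Function.Injective m) (hr : ∀ a, J.ReducedEdge M₁ a (m a))
    (hT : ∀ h ∉ J.evenR M₁, ∃ a, m a = h) : J.IsPopularAssignment m := by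
  have c := bipartiteColoring fun a h => h ∈ J.firstChoices a
  have hdisj : ∀ v, v ∈ evenVerts M₁ → v ∉ oddVerts M₁ :=
    fun v => notMem_oddVerts_of_mem_evenVerts c hM₁
  have hlist : ∀ a, m a ∈ J.list a := fun a => by
    rcases hr a with h | h
    · exact h.1.1
    · exact h.2.1
  -- An agent with a house in `T` has a first choice there, and is not odd.
  have hfirst : ∀ a, m a ∉ J.evenR M₁ → m a ∈ J.firstChoices a ∧ a ∉ J.oddL M₁ := by
    intro a ha
    rcases hr a with ⟨h, h1 | h1 | h1⟩ | h
    · exact ⟨h, (mem_unreachableVerts.1 h1.1).2⟩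
    · exact absurd h1.2 ha
    · exact ⟨h, hdisj _ h1.1⟩
    · exact absurd h.2.2.1 ha
  refine ⟨⟨hm, hlist⟩, fun n hn => ?_⟩
  have hfin : ∀ s : Set A, s.Finite := fun s => s.toFinite
  have hfinH : ∀ s : Set H, s.Finite := fun s => s.toFinite
  set P := {a | J.rank a (n a) < J.rank a (m a)}
  set W := {a | J.rank a (m a) < J.rank a (n a)}
  set T : Set H := (J.evenR M₁)ᶜ
  set B := {a | m a ∈ T}
  set Q := {a | a ∈ B ∧ n a ∈ T}
  have h1 : T.ncard ≤ B.ncard := by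
    have : T ⊆ m '' B := fun h hh => by
      obtain ⟨a, rfl⟩ := hT h hh
      exact ⟨a, hh, rfl⟩
    exact (Set.ncard_le_ncard this (hfinH _)).trans (Set.ncard_image_le (hfin _))
  have hPT : ∀ a ∈ P, n a ∈ T := by
    intro a ha he
    rcases hr a with h | h
    · exact absurd (h.1.2 _ (hn.2 a)) (not_le.2 ha)
    · exact absurd (h.2.2.2 _ (hn.2 a) he) (not_le.2 ha)
  have hPQ : Disjoint P Q := by
    rw [Set.disjoint_left]
    intro a ha hq
    exact absurd ((hfirst a hq.1).1.2 _ (hn.2 a)) (not_le.2 ha)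
  have h2 : P.ncard + Q.ncard ≤ T.ncard := by
    rw [← Set.ncard_union_eq hPQ (hfin _) (hfin _)]
    refine Set.ncard_le_ncard_of_injOn n ?_ hn.1.injOn (hfinH _)
    rintro a (ha | ha)
    · exact hPT a ha
    · exact ha.2
  have h3 : B ⊆ Q ∪ W := by
    intro b hb
    by_cases hnb : n b ∈ T
    · exact Or.inl ⟨hb, hnb⟩
    · refine Or.inr ?_
      by_contra hle
      obtain ⟨hbf, hbo⟩ := hfirst b hb
      have hnf : n b ∈ J.firstChoices b :=
        ⟨hn.2 b, fun x hx => (not_lt.1 hle).trans (hbf.2 x hx)⟩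
      have hadj : J.firstChoiceGraph.Adj (Sum.inr (n b)) (Sum.inl b) := hnf
      exact hbo (mem_oddVerts_of_adj c hM₁.1 (not_not.1 hnb) hadj)
  have h4 := Set.ncard_le_ncard h3 (hfin _)
  have h5 := Set.ncard_union_le Q W
  omega

/-! ### Perfect matchings of the reduced graph -/

/-- The perfect matchings of a bipartite graph are the bijections between its sides that follow
the edges. -/
lemma numPerfectMatchings_bipartiteGraph {L R : Type*} (r : L → R → Prop) :
    numPerfectMatchings (bipartiteGraph r) = Nat.card {e : L ≃ R // ∀ x, r x (e x)} := by
  symm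
  have hmatch (e : {e : L ≃ R // ∀ x, r x (e x)}) :
      (subgraphOfLE (bipartiteGraph fun x y => e.1 x = y)
        (bipartiteGraph_mono (r := r) (by rintro x y rfl; exact e.2 x))).IsPerfectMatching := by
    refine ⟨isMatching_bipartite (by rintro x y rfl; exact e.2 x)
      (fun _ _ _ h h' => h.symm.trans h') fun _ _ _ h h' => e.1.injective (h.trans h'.symm), ?_⟩
    rintro (x | y)
    · exact ⟨Sum.inr (e.1 x), (rfl : e.1 x = e.1 x)⟩
    · exact ⟨Sum.inl (e.1.symm y), e.1.apply_symm_apply y⟩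
  refine Nat.card_congr (Equiv.ofBijective (fun e => ⟨_, hmatch e⟩) ⟨?_, ?_⟩)
  · intro e e' h
    have h' := congrArg Subgraph.Adj (Subtype.ext_iff.1 h)
    ext x
    have h2 := congrFun (congrFun h' (Sum.inl x)) (Sum.inr (e'.1 x))
    exact h2.mpr (rfl : e'.1 x = e'.1 x)
  · rintro ⟨M, hM⟩
    have hM' := Subgraph.isPerfectMatching_iff.1 hM
    have hl : ∀ x, ∃ y, M.Adj (Sum.inl x) (Sum.inr y) := by
      intro x
      obtain ⟨z | z, hz, -⟩ := hM' (Sum.inl x)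
      · exact hz.adj_sub.elim
      · exact ⟨z, hz⟩
    have hr : ∀ y, ∃ x, M.Adj (Sum.inl x) (Sum.inr y) := by
      intro y
      obtain ⟨z | z, hz, -⟩ := hM' (Sum.inr y)
      · exact ⟨z, hz.symm⟩
      · exact hz.adj_sub.elim
    choose f hf using hl
    choose g hg using hr
    have hu : ∀ x y, M.Adj (Sum.inl x) (Sum.inr y) → f x = y := fun x y h =>
      Sum.inr_injective (hM.1.eq_of_adj_left (hf x) h)
    have hu' : ∀ x y, M.Adj (Sum.inl x) (Sum.inr y) → g y = x := fun x y h =>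
      Sum.inl_injective (hM.1.eq_of_adj_right (hg y) h)
    refine ⟨⟨⟨f, g, fun x => hu' _ _ (hf x), fun y => hu _ _ (hg y)⟩,
      fun x => (hf x).adj_sub⟩, Subtype.ext ?_⟩
    refine isMatching_ext (hmatch _).1 hM.1 ?_
    rintro (x | x) (y | y)
    · exact ⟨fun h => h.elim, fun h => h.adj_sub.elim⟩
    · exact ⟨fun h => (h : f x = y) ▸ hf x, fun h => hu x y h⟩
    · refine ⟨fun h => ?_, fun h => hu y x h.symm⟩
      obtain rfl : f y = x := h
      exact (hf y).symm
    · exact ⟨fun h => h.elim, fun h => h.adj_sub.elim⟩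

/-- A popular assignment leaves as many kept houses unused as there are dummy agents, and they are
even; so it extends to a perfect matching of the reduced graph. -/
lemma exists_equiv_of_isPopularAssignment (hp : J.HasPrivateHouses) (hM₁ : IsMaximumMatching M₁)
    (hm : J.IsPopularAssignment m) : ∃ e : (A ⊕ J.Dummy M₁) ≃ J.KeptHouse M₁,
      (∀ a, (e (Sum.inl a)).1 = m a) ∧
      ∀ d, (e (Sum.inr d)).1 ∈ J.evenRf M₁ ∪ J.evenRfs M₁ ∪ J.evenRs M₁ := by
  classical
  have hr := reducedEdge_of_isPopularAssignment hp hM₁ hm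
  let k : A → J.KeptHouse M₁ := fun a => ⟨m a, notMem_evenRstar_of_reducedEdge (hr a)⟩
  have hk : Function.Injective k := fun a b h => hm.1.1 (congrArg Subtype.val h)
  have hcard : Nat.card (J.Dummy M₁) = Nat.card ↥(Set.range k)ᶜ := by
    have h1 := Set.ncard_add_ncard_compl (Set.range k)
    have h2 : (Set.range k).ncard = Nat.card A := by
      rw [← Set.image_univ, Set.ncard_image_of_injective _ hk, Set.ncard_univ]
    rw [Nat.card_coe_set_eq, Nat.card_fin, numDummies]
    omega
  let e₁ : J.Dummy M₁ ≃ ↥(Set.range k)ᶜ := (Finite.card_eq.1 hcard).some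
  refine ⟨((Equiv.ofInjective k hk).sumCongr e₁).trans (Equiv.Set.sumCompl (Set.range k)),
    fun a => by simp [k], fun d => ?_⟩
  have hE : (e₁ d).1.1 ∈ J.evenR M₁ := by
    by_contra hh
    obtain ⟨a, -, ha⟩ := exists_firstChoices_of_notMem_evenR hp hM₁ hm hh
    exact (e₁ d).2 ⟨a, Subtype.ext ha⟩
  have hs : (e₁ d).1.1 ∉ J.evenRstar M₁ := (e₁ d).1.2
  simp only [evenRstar, evenRf, evenRfs, evenRs, Set.mem_union, Set.mem_inter_iff,
    Set.mem_compl_iff, Equiv.trans_apply, Equiv.sumCongr_apply, Sum.map_inr,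
    Equiv.Set.sumCompl_apply_inr] at hs ⊢
  tauto

lemma numPerfectMatchings_reducedGraph (hp : J.HasPrivateHouses) (hM₁ : IsMaximumMatching M₁) :
    numPerfectMatchings (J.reducedGraph M₁) =
      (Nat.card (J.Dummy M₁)).factorial * Nat.card {m // J.IsPopularAssignment m} := by
  classical
  have hex := fun m : {m // J.IsPopularAssignment m} =>
    exists_equiv_of_isPopularAssignment hp hM₁ m.2
  choose e he hd using hex
  rw [reducedGraph, numPerfectMatchings_bipartiteGraph, ← Nat.card_perm, ← Nat.card_prod]
  symm
  refine Nat.card_congr (Equiv.ofBijective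
    (fun q => ⟨((Equiv.refl A).sumCongr q.1).trans (e q.2), ?_⟩) ⟨?_, ?_⟩)
  · rintro (a | d)
    · have := reducedEdge_of_isPopularAssignment hp hM₁ q.2.2 a
      rw [← he q.2 a] at this
      exact this
    · exact hd q.2 (q.1 d)
  · rintro ⟨σ, m⟩ ⟨σ', m'⟩ h
    have h := Subtype.ext_iff.1 h
    have hmm : m = m' := by
      ext a
      rw [← he m a, ← he m' a]
      exact congrArg Subtype.val (DFunLike.congr_fun h (Sum.inl a))
    subst hmm
    congr 1
    ext d
    have := (e m).injective (DFunLike.congr_fun h (Sum.inr d))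
    exact congrArg _ (Sum.inr_injective this)
  · rintro ⟨f, hf⟩
    let m : A → H := fun a => (f (Sum.inl a)).1
    have hm : J.IsPopularAssignment m := by
      refine isPopularAssignment_of_reducedEdge hM₁
        (fun a b hab => Sum.inl_injective (f.injective (Subtype.ext hab)))
        (fun a => hf (Sum.inl a)) fun h hh => ?_
      have hk : h ∉ J.evenRstar M₁ := fun h' => hh h'.1
      obtain ⟨a | d, hx⟩ := f.surjective ⟨h, hk⟩
      · exact ⟨a, congrArg Subtype.val hx⟩
      · have := hf (Sum.inr d)
        rw [hx] at this
        rcases this with (h1 | h1) | h1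
        all_goals exact absurd h1.1 hh
    let τ : Equiv.Perm (A ⊕ J.Dummy M₁) := f.trans (e ⟨m, hm⟩).symm
    have hτ : ∀ a, τ (Sum.inl a) = Sum.inl a := fun a =>
      (Equiv.symm_apply_eq _).2 (Subtype.ext (he ⟨m, hm⟩ a).symm)
    obtain ⟨⟨σ₁, σ₂⟩, hσ⟩ := Equiv.Perm.mem_sumCongrHom_range_of_perm_mapsTo_inl (σ := τ)
      (by rintro _ ⟨a, rfl⟩; exact ⟨a, (hτ a).symm⟩)
    refine ⟨(σ₂, ⟨m, hm⟩), Subtype.ext (Equiv.ext ?_)⟩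
    have hfe : ∀ x, f x = e ⟨m, hm⟩ (τ x) := fun x => by simp [τ]
    rintro (a | d)
    · rw [hfe, hτ]
      rfl
    · rw [hfe, ← hσ]
      rfl

end HAT

/-! ### Popular matchings and popular assignments -/

namespace HAT

open SimpleGraph

variable {A H : Type*}

section Complete

variable {J : HAT A H}

/-- The matching of an assignment. -/
def matchingOf (m : {m : A → H // J.IsAssignment m}) : J.graph.Subgraph :=
  subgraphOfLE (bipartiteGraph fun a h => m.1 a = h)
    (bipartiteGraph_mono (by rintro a h rfl; exact m.2.2 a))

lemma matchingOf_isMatching (m : {m : A → H // J.IsAssignment m}) : (matchingOf m).IsMatching :=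
  isMatching_bipartite (by rintro a h rfl; exact m.2.2 a) (fun _ _ _ h h' => h.symm.trans h')
    fun _ _ _ h h' => m.2.1 (h.trans h'.symm)

lemma matchingOf_adj {m : {m : A → H // J.IsAssignment m}} {a : A} {h : H} :
    (matchingOf m).Adj (Sum.inl a) (Sum.inr h) ↔ m.1 a = h :=
  Iff.rfl

lemma prefers_matchingOf {m n : {m : A → H // J.IsAssignment m}} {a : A} :
    J.Prefers (matchingOf m) (matchingOf n) a ↔ J.rank a (m.1 a) < J.rank a (n.1 a) := by
  constructor
  · rintro (⟨-, h⟩ | ⟨h, h', h1, h2, h3⟩)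
    · exact (h ⟨Sum.inr (n.1 a), matchingOf_adj.2 rfl⟩).elim
    · rwa [matchingOf_adj.1 h1, matchingOf_adj.1 h2]
  · exact fun h => Or.inr ⟨_, _, matchingOf_adj.2 rfl, matchingOf_adj.2 rfl, h⟩

/-- Agents that a matching leaves out can have their private houses. -/
lemma exists_isAssignment_extending (hp : J.HasPrivateHouses) {N : J.graph.Subgraph}
    (hN : N.IsMatching) : ∃ n : {n : A → H // J.IsAssignment n},
      ∀ a h, N.Adj (Sum.inl a) (Sum.inr h) → n.1 a = h := by
  have hex : ∀ a, ∃ x ∈ J.list a, (∀ h, N.Adj (Sum.inl a) (Sum.inr h) → x = h) ∧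
      (N.Adj (Sum.inl a) (Sum.inr x) ∨ ∀ b, x ∈ J.list b → b = a) := by
    intro a
    by_cases ha : ∃ h, N.Adj (Sum.inl a) (Sum.inr h)
    · obtain ⟨h, hh⟩ := ha
      exact ⟨h, hh.adj_sub, fun h' hh' => Sum.inr_injective (hN.eq_of_adj_left hh hh'), Or.inl hh⟩
    · obtain ⟨l, hl, hl'⟩ := hp a
      exact ⟨l, hl, fun h hh => (ha ⟨h, hh⟩).elim, Or.inr hl'⟩
  choose n hn hn' hn'' using hex
  refine ⟨⟨n, fun a b hab => ?_, hn⟩, hn'⟩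
  rcases hn'' a with h1 | h1
  · rcases hn'' b with h2 | h2
    · rw [hab] at h1
      exact Sum.inl_injective (hN.eq_of_adj_right h1 h2)
    · exact h2 a (hab ▸ hn a)
  · exact (h1 b (hab ▸ hn b)).symm

variable [Finite A]

lemma isPopular_matchingOf (hp : J.HasPrivateHouses) (m : {m : A → H // J.IsAssignment m}) :
    J.IsPopular (matchingOf m) ↔ J.IsPopularAssignment m.1 := by
  refine ⟨fun h => ⟨m.2, fun n hn => ?_⟩, fun h => ⟨matchingOf_isMatching m, ?_⟩⟩
  · have h1 := not_lt.1 fun h1 => h.2 ⟨matchingOf ⟨n, hn⟩, matchingOf_isMatching _, h1⟩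
    simpa only [votes, prefers_matchingOf] using h1
  · rintro ⟨N, hN, hlt⟩
    obtain ⟨n, hn⟩ := exists_isAssignment_extending hp hN
    refine absurd (h.2 n.1 n.2) (not_le.2 (lt_of_le_of_lt ?_ (hlt.trans_le ?_)))
    · refine Set.ncard_le_ncard (fun a ha => ?_) (Set.toFinite _)
      by_cases hs : Sum.inl a ∈ N.support
      · obtain ⟨x | x, hx⟩ := hs
        · exact hx.adj_sub.elim
        · refine Or.inr ⟨m.1 a, x, matchingOf_adj.2 rfl, hx, ?_⟩
          rw [← hn a x hx]
          exact ha
      · exact Or.inl ⟨⟨Sum.inr (m.1 a), matchingOf_adj.2 rfl⟩, hs⟩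
    · refine Set.ncard_le_ncard (fun a ha => ?_) (Set.toFinite _)
      rcases ha with ⟨-, h1⟩ | ⟨x, y, h1, h2, h3⟩
      · exact (h1 ⟨Sum.inr (m.1 a), matchingOf_adj.2 rfl⟩).elim
      · show J.rank a (n.1 a) < J.rank a (m.1 a)
        rwa [hn a x h1, matchingOf_adj.1 h2]

lemma exists_matchingOf_eq (hp : J.HasPrivateHouses) {M : J.graph.Subgraph}
    (hM : J.IsPopular M) : ∃ m, matchingOf m = M := by
  obtain ⟨m, hm⟩ := exists_isAssignment_extending hp hM.1
  refine ⟨m, ?_⟩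
  have hsupp : ∀ a, Sum.inl a ∈ M.support := by
    by_contra! ha
    obtain ⟨a, ha⟩ := ha
    refine hM.2 ⟨matchingOf m, matchingOf_isMatching m, ?_⟩
    -- Everybody keeps the house assigned by `M`, and `a` gains one.
    have h1 : J.votes M (matchingOf m) = 0 := by
      rw [votes, Set.ncard_eq_zero (Set.toFinite _)]
      ext b
      simp only [Set.mem_ofPred_eq, Set.mem_empty_iff_false, iff_false]
      rintro (⟨-, h⟩ | ⟨h, h', h1, h2, h3⟩)
      · exact h ⟨Sum.inr (m.1 b), matchingOf_adj.2 rfl⟩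
      · rw [← matchingOf_adj.1 h2, hm b h h1] at h3
        exact h3.false
    have h2 : 0 < J.votes (matchingOf m) M :=
      (Set.ncard_pos (Set.toFinite _)).2 ⟨a, Or.inl ⟨⟨Sum.inr (m.1 a), matchingOf_adj.2 rfl⟩, ha⟩⟩
    rw [MorePopular, h1]
    exact h2
  have hadj : ∀ a h, (matchingOf m).Adj (Sum.inl a) (Sum.inr h) ↔
      M.Adj (Sum.inl a) (Sum.inr h) := by
    refine fun a h => ⟨fun h1 => ?_, fun h1 => matchingOf_adj.2 (hm a h h1)⟩
    obtain ⟨x | x, hx⟩ := hsupp a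
    · exact hx.adj_sub.elim
    · rwa [← matchingOf_adj.1 h1, hm a x hx]
  refine isMatching_ext (matchingOf_isMatching m) hM.1 ?_
  rintro (x | x) (y | y)
  · exact ⟨fun h => h.adj_sub.elim, fun h => h.adj_sub.elim⟩
  · exact hadj x y
  · exact ((matchingOf m).adj_comm _ _).trans ((hadj y x).trans (M.adj_comm _ _))
  · exact ⟨fun h => h.adj_sub.elim, fun h => h.adj_sub.elim⟩

lemma numPopular_eq_card (hp : J.HasPrivateHouses) :
    J.numPopular = Nat.card {m // J.IsPopularAssignment m} := by
  symm
  refine Nat.card_congr (Equiv.ofBijective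
    (fun m => ⟨matchingOf ⟨m.1, m.2.1⟩, (isPopular_matchingOf hp _).2 m.2⟩) ⟨?_, ?_⟩)
  · intro m m' h
    have h' := congrArg Subgraph.Adj (Subtype.ext_iff.1 h)
    ext a
    have h2 := congrFun (congrFun h' (Sum.inl a)) (Sum.inr (m'.1 a))
    exact h2.mpr (rfl : m'.1 a = m'.1 a)
  · rintro ⟨M, hM⟩
    obtain ⟨m, rfl⟩ := exists_matchingOf_eq hp hM
    exact ⟨⟨m.1, (isPopular_matchingOf hp m).1 hM⟩, rfl⟩

end Complete

/-! ### Dropping the last-resort houses -/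

section LastResort

variable [Fintype H] {I : HAT A H}

lemma hasPrivateHouses_withLastResort : I.withLastResort.HasPrivateHouses := by
  refine fun a => ⟨Sum.inr a, Or.inr rfl, fun b hb => ?_⟩
  rcases hb with ⟨h, -, h'⟩ | h'
  · exact (Sum.inr_ne_inl h').elim
  · exact (Sum.inr_injective h').symm

lemma inl_mem_list {a : A} {h : H} :
    Sum.inl h ∈ I.withLastResort.list a ↔ h ∈ I.list a := by
  refine ⟨?_, fun h' => Or.inl ⟨h, h', rfl⟩⟩
  rintro (⟨h', hh, h1⟩ | h1)
  · rwa [Sum.inl_injective h1]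
  · exact (Sum.inl_ne_inr h1).elim

lemma eq_of_inr_mem_list {a b : A} (h : Sum.inr b ∈ I.withLastResort.list a) : b = a := by
  rcases h with ⟨h', -, h1⟩ | h1
  · exact (Sum.inr_ne_inl h1).elim
  · exact Sum.inr_injective h1

/-- The matching of the original instance that drops the last-resort houses of an assignment. -/
def properMatching (m : {m : A → H ⊕ A // I.withLastResort.IsAssignment m}) : I.graph.Subgraph :=
  subgraphOfLE (bipartiteGraph fun a h => m.1 a = Sum.inl h)
    (bipartiteGraph_mono fun a _ hh => inl_mem_list.1 (hh ▸ m.2.2 a))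

lemma properMatching_isMatching (m : {m : A → H ⊕ A // I.withLastResort.IsAssignment m}) :
    (properMatching m).IsMatching :=
  isMatching_bipartite (fun a _ hh => inl_mem_list.1 (hh ▸ m.2.2 a))
    (fun _ _ _ h h' => Sum.inl_injective (h.symm.trans h'))
    fun _ _ _ h h' => m.2.1 (h.trans h'.symm)

lemma properMatching_adj {m : {m : A → H ⊕ A // I.withLastResort.IsAssignment m}} {a : A} {h : H} :
    (properMatching m).Adj (Sum.inl a) (Sum.inr h) ↔ m.1 a = Sum.inl h :=
  Iff.rfl

lemma inl_mem_properMatching {m : {m : A → H ⊕ A // I.withLastResort.IsAssignment m}} {a : A} :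
    Sum.inl a ∈ (properMatching m).support ↔ ∃ h, m.1 a = Sum.inl h := by
  constructor
  · rintro ⟨x | x, hx⟩
    · exact hx.elim
    · exact ⟨x, hx⟩
  · exact fun ⟨h, hh⟩ => ⟨Sum.inr h, hh⟩

lemma prefers_properMatching {m n : {m : A → H ⊕ A // I.withLastResort.IsAssignment m}} {a : A} :
    I.Prefers (properMatching m) (properMatching n) a ↔
      I.withLastResort.rank a (m.1 a) < I.withLastResort.rank a (n.1 a) := by
  simp only [Prefers, inl_mem_properMatching, properMatching_adj]
  have hlt : ∀ h, I.rank a h < Finset.univ.sup (I.rank a) + 1 :=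
    fun h => Nat.lt_succ_of_le (Finset.le_sup (f := I.rank a) (Finset.mem_univ h))
  rcases hm : m.1 a with x | x <;> rcases hn : n.1 a with y | y <;>
    simp [withLastResort, hlt, (hlt _).le]

lemma exists_properMatching_eq {N : I.graph.Subgraph} (hN : N.IsMatching) :
    ∃ n, properMatching n = N := by
  have hex : ∀ a, ∃ x ∈ I.withLastResort.list a,
      ∀ h, N.Adj (Sum.inl a) (Sum.inr h) ↔ x = Sum.inl h := by
    intro a
    by_cases ha : ∃ h, N.Adj (Sum.inl a) (Sum.inr h)
    · obtain ⟨h, hh⟩ := ha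
      refine ⟨Sum.inl h, inl_mem_list.2 hh.adj_sub, fun h' => ⟨fun hh' => ?_, fun h' => ?_⟩⟩
      · rw [Sum.inr_injective (hN.eq_of_adj_left hh hh')]
      · rwa [← Sum.inl_injective h']
    · exact ⟨Sum.inr a, Or.inr rfl, fun h => ⟨fun hh => (ha ⟨h, hh⟩).elim, fun h => by simp at h⟩⟩
  choose n hn hn' using hex
  have hinj : Function.Injective n := by
    intro a b hab
    rcases h : n a with x | x
    · exact Sum.inl_injective (hN.eq_of_adj_right ((hn' a x).2 h) ((hn' b x).2 (hab ▸ h)))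
    · have ha := hn a
      have hb := hn b
      rw [h] at ha
      rw [← hab, h] at hb
      rw [← eq_of_inr_mem_list ha, ← eq_of_inr_mem_list hb]
  refine ⟨⟨n, hinj, hn⟩, isMatching_ext (properMatching_isMatching _) hN ?_⟩
  rintro (x | x) (y | y)
  · exact ⟨fun h => h.adj_sub.elim, fun h => h.adj_sub.elim⟩
  · exact (hn' x y).symm
  · exact (Subgraph.adj_comm _ _ _).trans ((hn' y x).symm.trans (N.adj_comm _ _))
  · exact ⟨fun h => h.adj_sub.elim, fun h => h.adj_sub.elim⟩

lemma isPopular_properMatching (m : {m : A → H ⊕ A // I.withLastResort.IsAssignment m}) :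
    I.IsPopular (properMatching m) ↔ I.withLastResort.IsPopularAssignment m.1 := by
  refine ⟨fun h => ⟨m.2, fun n hn => ?_⟩, fun h => ⟨properMatching_isMatching m, ?_⟩⟩
  · have h1 := not_lt.1 fun h1 => h.2 ⟨properMatching ⟨n, hn⟩, properMatching_isMatching _, h1⟩
    simpa only [votes, prefers_properMatching] using h1
  · rintro ⟨N, hN, hlt⟩
    obtain ⟨n, rfl⟩ := exists_properMatching_eq hN
    simp only [MorePopular, votes, prefers_properMatching] at hlt
    exact absurd (h.2 n.1 n.2) (not_le.2 hlt)

lemma numPopular_eq_card_withLastResort :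
    I.numPopular = Nat.card {m // I.withLastResort.IsPopularAssignment m} := by
  symm
  refine Nat.card_congr (Equiv.ofBijective
    (fun m => ⟨properMatching ⟨m.1, m.2.1⟩, (isPopular_properMatching _).2 m.2⟩) ⟨?_, ?_⟩)
  · intro m m' h
    have h' := congrArg Subgraph.Adj (Subtype.ext_iff.1 h)
    have hiff : ∀ a h, m.1 a = Sum.inl h ↔ m'.1 a = Sum.inl h := fun a h =>
      iff_of_eq (congrFun (congrFun h' (Sum.inl a)) (Sum.inr h))
    ext a
    rcases hm : m.1 a with x | x
    · exact ((hiff a x).1 hm).symm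
    · rcases hm' : m'.1 a with y | y
      · rw [(hiff a y).2 hm'] at hm
        simp at hm
      · have ha := m.2.1.2 a
        have ha' := m'.2.1.2 a
        rw [hm] at ha
        rw [hm'] at ha'
        rw [eq_of_inr_mem_list ha, eq_of_inr_mem_list ha']
  · rintro ⟨M, hM⟩
    obtain ⟨m, rfl⟩ := exists_properMatching_eq hM.1
    exact ⟨⟨m.1, (isPopular_properMatching m).1 hM⟩, rfl⟩

end LastResort

end HAT

theorem mainTheorem2 {A H : Type*} [Fintype A] [Fintype H] (I : HAT A H)
    (M₁ : I.withLastResort.firstChoiceGraph.Subgraph) (hM₁ : IsMaximumMatching M₁) :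
    ((∃ M, I.withLastResort.IsPopular M) →
      Nat.card A ≤ Nat.card (I.withLastResort.KeptHouse M₁)) ∧
    numPerfectMatchings (I.withLastResort.reducedGraph M₁) =
      (Nat.card (I.withLastResort.Dummy M₁)).factorial * I.withLastResort.numPopular ∧
    I.withLastResort.numPopular = I.numPopular := by
  have hp : I.withLastResort.HasPrivateHouses := HAT.hasPrivateHouses_withLastResort
  refine ⟨?_, ?_, ?_⟩
  · rintro ⟨M, hM⟩
    obtain ⟨m, rfl⟩ := HAT.exists_matchingOf_eq hp hM
    obtain ⟨e, -, -⟩ :=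
      HAT.exists_equiv_of_isPopularAssignment hp hM₁ ((HAT.isPopular_matchingOf hp m).1 hM)
    exact Nat.card_le_card_of_injective (fun a => e (Sum.inl a))
      (e.injective.comp Sum.inl_injective)
  · rw [HAT.numPerfectMatchings_reducedGraph hp hM₁, HAT.numPopular_eq_card hp]
  · rw [HAT.numPopular_eq_card hp, HAT.numPopular_eq_card_withLastResort]
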